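/- **Market.** Let $E$ be a finite set of items and $N$ a finite set of buyers. Item $e$ is available in $b(e)\in\mathbb Z_+$ identical units. Each buyer $i\in N$ has a non-decreasing valuation $v_i\colon[0,b]_{\mathbb Z}\to\mathbb Z_+$, where $[0,b]_{\mathbb Z}=\{z\in\mathbb Z^E: 0\le z\le b\}$. For $p\in\mathbb R^E$ let $\mathcal D_i(p)=\arg\max\{v_i(z)-\sum_{e} p(e)z(e): z\in[0,b]_{\mathbb Z}\}$. A price vector $p\in\mathbb R_+^E$ is *Walrasian* (for supply $b$ and valuations $(v_i)_{i\in N}$) if there are $z_i\in\mathcal D_i(p)$, $i\in N$, with $\sum_{i\in N} z_i(e)=b(e)$ for all $e\in E$. It is the *minimal* [*maximal*] Walrasian price vector if it is Walrasian and $p(e)\le q(e)$ [$p(e)\ge q(e)$] for every Walrasian $q$ and every item $e$ with $b(e)>0$; prices of items without supply are irrelevant and are not compared. **Strong gross substitutes.** Let $\tilde E=\{(e,k): e\in E,\ 1\le k\le b(e)\}$ be the set of individual units, and for $S\subseteq\tilde E$ let $\tilde v_i(S)=v_i(z_S)$, where $z_S(e)$ is the number of units of $e$ in $S$. For $\tilde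 p\in\mathbb R^{\tilde E}$ let $\tilde{\mathcal D}_i(\tilde p)=\arg\max_{S\subseteq\tilde E}\{\tilde v_i(S)-\sum_{u\in S}\tilde p(u)\}$. The valuation $v_i$ is *strong gross substitutes* if for all $\tilde p\le\tilde q$ in $\mathbb R^{\tilde E}$ and all $S\in\tilde{\mathcal D}_i(\tilde p)$ there is $T\in\tilde{\mathcal D}_i(\tilde q)$ with $\{u\in S:\tilde p(u)=\tilde q(u)\}\subseteq T$ and $|T|\le|S|$. **Truncation.** For $d\in\mathbb Z_+^N$ let $v_i^d(z)=\max\{v_i(y): 0\le y\le z,\ \sum_{e\in E}y(e)\le d_i\}$. **Theorem.** Suppose that all $v_i$ are non-decreasing and strong gross substitutes on $[0,b]_{\mathbb Z}$. 1. (Supply.) Let $b'\in\mathbb Z_+^E$ with $b'\le b$. If $p$ is the minimal Walrasian price vector for supply $b$ and valuations $v_i$, and $p'$ is the minimal Walrasian price vector for supply $b'$ and the restricted valuations $v_i|_{[0,b']_{\mathbb Z}}$, then $p(e)\le p'(e)$ for all $e\in E$ with $b'(e)>0$. The same holds with "maximal" in place of both occurrences of "minimal". 2. (Demand.) Let $d,d'\in\mathbb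 Z_+^N$ with $d'\le d$. If $p$ and $p'$ are the minimal Walrasian price vectors for supply $b$ and the truncated valuations $(v_i^{d})_{i\in N}$ and $(v_i^{d'})_{i\in N}$, respectively, then $p'(e)\le p(e)$ for all $e\in E$ with $b(e)>0$. The same holds with "maximal" in place of "minimal". -/

import Mathlib

open scoped BigOperators

/-- The utility `v(z) - ⟨p, z⟩` of a bundle `z` at prices `p`. -/
noncomputable def utility {E : Type*} [Fintype E] (v : (E → ℕ) → ℕ) (p : E → ℝ) (z : E → ℕ) : ℝ :=
  (v z : ℝ) - ∑ e, p e * (z e : ℝ)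

/-- The set of preferred bundles at prices `p`: the maximizers of the utility over all bundles
`0 ≤ z ≤ b`. Only the values of `v` on the box `[0, b]` matter, so that for `b' ≤ b` the demand
set `demandSet b' v p` is the one of the restriction of `v` to `[0, b']`. -/
def demandSet {E : Type*} [Fintype E] (b : E → ℕ) (v : (E → ℕ) → ℕ) (p : E → ℝ) :
    Set (E → ℕ) :=
  {z | z ≤ b ∧ ∀ y : E → ℕ, y ≤ b → utility v p y ≤ utility v p z}

/-- Gross substitutes together with the law of aggregate demand, for prices per item:
if prices rise from `p` to `q`, then for each bundle preferred at `p` there is a bundle preferred at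
`q` that contains no fewer units of the items whose price is unchanged, and that is not larger
in total. -/
def SatisfiesSubstitutes {E : Type*} [Fintype E] (b : E → ℕ) (v : (E → ℕ) → ℕ) : Prop :=
  ∀ p q : E → ℝ, p ≤ q → ∀ x ∈ demandSet b v p, ∃ y ∈ demandSet b v q,
    (∀ e, p e = q e → x e ≤ y e) ∧ ∑ e, y e ≤ ∑ e, x e

/-- The valuation of the unit-supply market in which each of the `b e` units of the item `e` is an
item `⟨e, k⟩` of its own: a bundle of units has the value of the bundle that records the number
of its units of each type. -/
def unitValuation {E : Type*} (b : E → ℕ) (v : (E → ℕ) → ℕ) :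
    ((Σ e : E, Fin (b e)) → ℕ) → ℕ :=
  fun z => v fun e => ∑ k : Fin (b e), z ⟨e, k⟩

/-- Strong gross substitutes valuations on the box `[0, b]`: the substitutes condition holds with
every unit of every item treated as an individual item, with its own price. For prices
that agree on the units of an item it gives `SatisfiesSubstitutes b v`, and for `b = 1` it is that
condition. (For `b ≠ 1`, `SatisfiesSubstitutes b v` alone is strictly weaker: for one item it
does not force the marginal values to be non-increasing.) -/
def IsStrongGrossSubstitutes {E : Type*} [Fintype E] (b : E → ℕ) (v : (E → ℕ) → ℕ) : Prop :=
  SatisfiesSubstitutes (fun _ : Σ e : E, Fin (b e) => 1) (unitValuation b v)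

/-- `p` is a Walrasian price vector: `p` is nonnegative, and every buyer can be given a preferred
bundle so that every unit of every item is sold exactly once. -/
def IsWalrasian {E N : Type*} [Fintype E] [Fintype N] (b : E → ℕ) (v : N → (E → ℕ) → ℕ)
    (p : E → ℝ) : Prop :=
  (∀ e, 0 ≤ p e) ∧
    ∃ z : N → E → ℕ, (∀ i, z i ∈ demandSet b (v i) p) ∧ ∀ e, ∑ i, z i e = b e

/-- `p` is a minimal (buyer-optimal) Walrasian price vector. Price vectors are compared on the items
in the market, that is, those of positive supply: the price of an item without supply
is arbitrary and has no meaning. -/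
def IsMinWalrasian {E N : Type*} [Fintype E] [Fintype N] (b : E → ℕ) (v : N → (E → ℕ) → ℕ)
    (p : E → ℝ) : Prop :=
  IsWalrasian b v p ∧ ∀ q, IsWalrasian b v q → ∀ e, 0 < b e → p e ≤ q e

/-- `p` is a maximal (seller-optimal) Walrasian price vector, again with respect to the items of
positive supply. -/
def IsMaxWalrasian {E N : Type*} [Fintype E] [Fintype N] (b : E → ℕ) (v : N → (E → ℕ) → ℕ)
    (p : E → ℝ) : Prop :=
  IsWalrasian b v p ∧ ∀ q, IsWalrasian b v q → ∀ e, 0 < b e → q e ≤ p e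

/-- The item-truncation of a valuation to demand `d`:
`z ↦ max {v y | y ≤ z, ∑ e, y e ≤ d}`. The maximum is over a set that contains `0`. -/
def truncation {E : Type*} [Fintype E] [DecidableEq E] (v : (E → ℕ) → ℕ) (d : ℕ)
    (z : E → ℕ) : ℕ :=
  ((Finset.Iic z).filter fun y => ∑ e, y e ≤ d).sup v

/-! ### Indirect utility and its response to price changes -/

section IndirectUtility

variable {E : Type*} [Fintype E]

/-! Walrasian prices are dual optima. Let L(p) be total indirect utility plus the value of the
supply (`lyapunov`). A Walrasian p minimises L, and any nonnegative price vector with as small a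
value is supported by the same allocation. So if p, p' are Walrasian in two markets and L(r) +
L'(r') ≤ L(p) + L'(p') with r, r' nonnegative, then r and r' are Walrasian in their markets
(`IsWalrasian.of_lyapunov_add_le`). Taking essentially the meet and the join of p and p' for r and
r', extremality of p or p' gives each claim.

The exchange inequalities come from single units. Gross substitutes makes the indirect utility V
submodular, and the law of aggregate demand strengthens this to L♮-convexity
(`indirectUtility_sup_add_inf_translate_le`).

Demand: at nonnegative prices the truncated indirect utility is the minimum over t ≥ 0 of V(p + t) +
t d. There is no duality gap because the sizes of preferred bundles form an interval
(`exists_mem_demandSet_sum_eq`). L♮-convexity accommodates the two different multipliers.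

Supply: withdrawing units amounts to pricing them at a prohibitive M, so submodularity over units
applies. The resulting prices may differ within an item; interchanging units and taking meets
equalises them (`isWalrasian_of_unitPrice`). -/

theorem exists_mem_demandSet (b : E → ℕ) (v : (E → ℕ) → ℕ) (p : E → ℝ) :
    ∃ z, z ∈ demandSet b v p := by
  classical
  obtain ⟨z, hz, hmax⟩ := (Finset.Iic b).exists_max_image (utility v p) ⟨b, by simp⟩
  exact ⟨z, by simpa using hz, fun y hy => hmax y (by simpa using hy)⟩

/-- The indirect utility: the largest utility of a bundle in the box `[0, b]` at prices `p`. -/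
noncomputable def indirectUtility (b : E → ℕ) (v : (E → ℕ) → ℕ) (p : E → ℝ) : ℝ :=
  utility v p (exists_mem_demandSet b v p).choose

theorem utility_le_indirectUtility {b : E → ℕ} {v : (E → ℕ) → ℕ} {z : E → ℕ} (hz : z ≤ b)
    (p : E → ℝ) : utility v p z ≤ indirectUtility b v p :=
  (exists_mem_demandSet b v p).choose_spec.2 z hz

theorem utility_eq_of_mem_demandSet {b : E → ℕ} {v : (E → ℕ) → ℕ} {p : E → ℝ} {z : E → ℕ}
    (hz : z ∈ demandSet b v p) : utility v p z = indirectUtility b v p :=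
  le_antisymm (utility_le_indirectUtility hz.1 p)
    (hz.2 _ (exists_mem_demandSet b v p).choose_spec.1)

theorem mem_demandSet_of_indirectUtility_le {b : E → ℕ} {v : (E → ℕ) → ℕ} {p : E → ℝ}
    {z : E → ℕ} (hz : z ≤ b) (h : indirectUtility b v p ≤ utility v p z) :
    z ∈ demandSet b v p :=
  ⟨hz, fun _ hy => (utility_le_indirectUtility hy p).trans h⟩

theorem indirectUtility_le {b : E → ℕ} {v : (E → ℕ) → ℕ} {p : E → ℝ} {c : ℝ}
    (h : ∀ z ≤ b, utility v p z ≤ c) : indirectUtility b v p ≤ c :=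
  h _ (exists_mem_demandSet b v p).choose_spec.1

theorem utility_add (v : (E → ℕ) → ℕ) (p w : E → ℝ) (z : E → ℕ) :
    utility v (p + w) z = utility v p z - ∑ e, w e * (z e : ℝ) := by
  simp only [utility, Pi.add_apply, add_mul, Finset.sum_add_distrib]
  ring

theorem utility_add_single [DecidableEq E] (v : (E → ℕ) → ℕ) (p : E → ℝ) (e : E) (t : ℝ)
    (z : E → ℕ) : utility v (p + Pi.single e t) z = utility v p z - t * z e := by
  rw [utility_add]
  congr 1
  rw [Finset.sum_eq_single e]
  · simp
  · intro a _ ha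
    simp [ha]
  · simp

theorem utility_add_const (v : (E → ℕ) → ℕ) (p : E → ℝ) (t : ℝ) (z : E → ℕ) :
    utility v (p + fun _ => t) z = utility v p z - t * (∑ e, z e : ℕ) := by
  rw [utility_add, Nat.cast_sum, Finset.mul_sum]

/-- Small price changes do not make a bundle preferred that was not preferred before. -/
theorem eventually_demandSet_add_smul_subset (b : E → ℕ) (v : (E → ℕ) → ℕ) (p w : E → ℝ) :
    ∀ᶠ ε : ℝ in nhds 0, demandSet b v (p + ε • w) ⊆ demandSet b v p := by
  classical
  have key : ∀ z ∈ Finset.Iic b, ∀ᶠ ε : ℝ in nhds 0,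
      z ∈ demandSet b v (p + ε • w) → z ∈ demandSet b v p := by
    intro z hz
    by_cases h : z ∈ demandSet b v p
    · exact Filter.Eventually.of_forall fun _ _ => h
    · simp only [demandSet, Set.mem_ofPred_eq, not_and, not_forall, not_le] at h
      obtain ⟨y, hy, hlt⟩ := h (by simpa using hz)
      have hc : ∀ x : E → ℕ, Continuous fun ε : ℝ => utility v (p + ε • w) x := by
        intro x
        unfold utility
        simp only [Pi.add_apply, Pi.smul_apply, smul_eq_mul]
        fun_prop
      have := ((hc z).tendsto 0).eventually_lt ((hc y).tendsto 0) (by simpa using hlt)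
      filter_upwards [this] with ε hε hmem
      exact absurd (hmem.2 y hy) (not_le.2 hε)
  have := (Finset.eventually_all (Finset.Iic b)).2 key
  filter_upwards [this] with ε hε z hz
  exact hε z (by simpa using hz.1) hz

end IndirectUtility

/-! ### Submodularity and L♮-convexity from gross substitutes -/

section Substitutes

variable {U : Type*} [Fintype U] {w : (U → ℕ) → ℕ}

/-- Under gross substitutes, the loss from raising the price of one item does not decrease when
the prices of other items rise. -/
theorem indirectUtility_add_single_le [DecidableEq U]
    (h : SatisfiesSubstitutes (fun _ : U => 1) w)
    {p q : U → ℝ} (hpq : p ≤ q) {e : U} (he : p e = q e) {t : ℝ} (ht : 0 ≤ t) :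
    indirectUtility (fun _ => 1) w p + indirectUtility (fun _ => 1) w (q + Pi.single e t) ≤
      indirectUtility (fun _ => 1) w q +
        indirectUtility (fun _ => 1) w (p + Pi.single e t) := by
  have hanti : ∀ {a c : ℝ}, a ≤ c → indirectUtility (fun _ => 1) w (q + Pi.single e c) ≤
      indirectUtility (fun _ => 1) w (q + Pi.single e a) := by
    intro a c hac
    refine indirectUtility_le fun z hz => ?_
    refine le_trans ?_ (utility_le_indirectUtility hz _)
    rw [utility_add_single, utility_add_single]
    have : (0 : ℝ) ≤ z e := Nat.cast_nonneg _
    nlinarith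
  obtain ⟨S, hS⟩ := exists_mem_demandSet (fun _ : U => 1) w p
  have hSu := utility_eq_of_mem_demandSet hS
  have hSt := utility_le_indirectUtility (v := w) hS.1 (p + Pi.single e t)
  rw [utility_add_single] at hSt
  -- The loss `s` at `p` is the largest rise, up to `t`, at which `S` stays preferred: bundles
  -- without `e` are worth at most `V(p) - s`, and those with `e` lose `s`. Substitutes then gives a
  -- bundle containing `e` at `q + s`, so the loss at `q` is at least `s`.
  set s := indirectUtility (fun _ => 1) w p - indirectUtility (fun _ => 1) w (p + Pi.single e t)
    with hs
  rcases le_or_gt s 0 with hs0 | hs0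
  · have := hanti ht
    simp only [Pi.single_zero, add_zero] at this
    linarith
  have hSe : S e = 1 := by
    have h1 : S e ≤ 1 := hS.1 e
    interval_cases h2 : S e
    · simp at hSt
      linarith
    · rfl
  have hst : s ≤ t := by
    rw [hSe] at hSt
    push_cast at hSt
    linarith
  have hSs : S ∈ demandSet (fun _ => 1) w (p + Pi.single e s) := by
    refine ⟨hS.1, fun y hy => ?_⟩
    rw [utility_add_single, utility_add_single, hSe]
    have h1 : y e ≤ 1 := hy e
    have h2 := utility_le_indirectUtility (v := w) hy p
    have h3 := utility_le_indirectUtility (v := w) hy (p + Pi.single e t)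
    rw [utility_add_single] at h3
    push_cast
    interval_cases h4 : y e
    · simp at h3 ⊢
      linarith
    · push_cast
      linarith
  obtain ⟨T, hT, hTe, -⟩ := h _ (q + Pi.single e s) (by gcongr) S hSs
  have hTe1 : T e = 1 := le_antisymm (hT.1 e) (hSe ▸ hTe e (by simp [he]))
  have h1 := utility_eq_of_mem_demandSet hT
  rw [utility_add_single, hTe1] at h1
  have h2 := utility_le_indirectUtility (v := w) hT.1 q
  have h3 := hanti hst
  push_cast at h1
  linarith

/-- The prices are raised one item at a time. The two price vectors still agree on an item until its
turn comes, so the one-item inequalities add up. -/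
theorem indirectUtility_add_indicator_le [DecidableEq U]
    (h : SatisfiesSubstitutes (fun _ : U => 1) w)
    {p q x : U → ℝ} (hpq : p ≤ q) (hx : 0 ≤ x) (F : Finset U) (hF : ∀ u ∈ F, p u = q u) :
    indirectUtility (fun _ => 1) w p +
        indirectUtility (fun _ => 1) w (q + fun u => if u ∈ F then x u else 0) ≤
      indirectUtility (fun _ => 1) w q +
        indirectUtility (fun _ => 1) w (p + fun u => if u ∈ F then x u else 0) := by
  induction F using Finset.induction_on with
  | empty =>
    have : (fun _ : U => (0 : ℝ)) = 0 := rfl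
    simp [this, add_comm]
  | insert e F he ih =>
    have ih := ih fun u hu => hF u (Finset.mem_insert_of_mem hu)
    have hsplit : (fun u => if u ∈ insert e F then x u else 0) =
        (fun u => if u ∈ F then x u else 0) + Pi.single e (x e) := by
      funext u
      by_cases hu : u = e
      · subst hu
        simp [he]
      · simp [hu]
    have := indirectUtility_add_single_le h (p := p + fun u => if u ∈ F then x u else 0)
      (q := q + fun u => if u ∈ F then x u else 0) (by gcongr) (e := e)
      (by simp [he, hF e (Finset.mem_insert_self e F)]) (hx e)
    rw [hsplit, ← add_assoc, ← add_assoc]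
    linarith

/-- The indirect utility of a gross substitutes valuation is submodular. -/
theorem indirectUtility_inf_add_sup_le (h : SatisfiesSubstitutes (fun _ : U => 1) w)
    (p q : U → ℝ) :
    indirectUtility (fun _ => 1) w (p ⊓ q) + indirectUtility (fun _ => 1) w (p ⊔ q) ≤
      indirectUtility (fun _ => 1) w p + indirectUtility (fun _ => 1) w q := by
  classical
  -- On the items with `q ≤ p` the vectors `p ⊓ q` and `q` agree; raising both there by `p - p ⊓ q`
  -- yields `p` and `p ⊔ q`.
  have := indirectUtility_add_indicator_le h (p := p ⊓ q) (q := q) (x := p - p ⊓ q)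
    inf_le_right (sub_nonneg.2 inf_le_left) (Finset.univ.filter fun u => q u ≤ p u)
    (by simp)
  have h1 : (q + fun u => if u ∈ Finset.univ.filter (fun u => q u ≤ p u) then
      (p - p ⊓ q) u else 0) = p ⊔ q := by
    funext u
    by_cases hu : q u ≤ p u
    · simp [hu]
    · simp [hu, (not_le.1 hu).le]
  have h2 : (p ⊓ q + fun u => if u ∈ Finset.univ.filter (fun u => q u ≤ p u) then
      (p - p ⊓ q) u else 0) = p := by
    funext u
    by_cases hu : q u ≤ p u
    · simp [hu]
    · simp [hu, (not_le.1 hu).le]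
  rw [h1, h2] at this
  linarith

/-- By the law of aggregate demand, the loss from a uniform rise of all prices does not increase
when prices rise. -/
theorem indirectUtility_add_const_le {b : U → ℕ} (h : SatisfiesSubstitutes b w)
    {p q : U → ℝ} (hpq : p ≤ q) {s : ℝ} (hs : 0 ≤ s) :
    indirectUtility b w q + indirectUtility b w (p + fun _ => s) ≤
      indirectUtility b w p + indirectUtility b w (q + fun _ => s) := by
  have hdem : ∀ t : ℝ, ∃ S T : U → ℕ, S ∈ demandSet b w (p + fun _ => t) ∧
      T ∈ demandSet b w (q + fun _ => t) ∧ ∑ u, T u ≤ ∑ u, S u := by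
    intro t
    obtain ⟨S, hS⟩ := exists_mem_demandSet b w (p + fun _ => t)
    obtain ⟨T, hT, -, hTS⟩ := h _ (q + fun _ => t) (by gcongr) S hS
    exact ⟨S, T, hS, hT, hTS⟩
  choose S T hS hT hTS using hdem
  -- Over a rise from `t` to `t + δ` the loss at `q` is at most `δ|T t|`, the loss at `p` at least
  -- `δ|S (t + δ)|`, and `|T t| ≤ |S t|`. The bounds telescope, leaving an error of at most `δ|S
  -- 0|`, which vanishes as the subdivision is refined.
  have hstep : ∀ t δ : ℝ, 0 ≤ δ →
      (indirectUtility b w (q + fun _ => t) - indirectUtility b w (q + fun _ => t + δ)) -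
        (indirectUtility b w (p + fun _ => t) - indirectUtility b w (p + fun _ => t + δ)) ≤
      δ * ((∑ u, S t u : ℕ) - (∑ u, S (t + δ) u : ℕ)) := by
    intro t δ hδ
    have h1 := utility_eq_of_mem_demandSet (hT t)
    have h2 := utility_le_indirectUtility (v := w) (hT t).1 (q + fun _ => t + δ)
    have h3 := utility_eq_of_mem_demandSet (hS (t + δ))
    have h4 := utility_le_indirectUtility (v := w) (hS (t + δ)).1 (p + fun _ => t)
    rw [utility_add_const] at h1 h2 h3 h4
    have h5 : ((∑ u, T t u : ℕ) : ℝ) ≤ (∑ u, S t u : ℕ) := by exact_mod_cast hTS t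
    nlinarith [mul_le_mul_of_nonneg_left h5 hδ]
  have hsum : ∀ (δ : ℝ), 0 ≤ δ → ∀ n : ℕ,
      (indirectUtility b w q - indirectUtility b w (q + fun _ => n * δ)) -
        (indirectUtility b w p - indirectUtility b w (p + fun _ => n * δ)) ≤
      δ * ((∑ u, S 0 u : ℕ) - (∑ u, S (n * δ) u : ℕ)) := by
    intro δ hδ n
    induction n with
    | zero =>
      have : (fun _ : U => (0 : ℝ)) = 0 := rfl
      simp [this]
    | succ n ih =>
      have := hstep (n * δ) δ hδ
      have h1 : ((n + 1 : ℕ) : ℝ) * δ = n * δ + δ := by push_cast; ring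
      rw [h1]
      linarith
  have hbound : ∀ n : ℕ, (indirectUtility b w q - indirectUtility b w (q + fun _ => s)) -
        (indirectUtility b w p - indirectUtility b w (p + fun _ => s)) ≤
      (s * (∑ u, S 0 u : ℕ)) / (n + 1 : ℕ) := by
    intro n
    have hn : (0 : ℝ) < (n + 1 : ℕ) := by positivity
    have h1 := hsum (s / (n + 1 : ℕ)) (by positivity) (n + 1)
    have h2 : ((n + 1 : ℕ) : ℝ) * (s / (n + 1 : ℕ)) = s := by field_simp
    rw [h2] at h1
    refine h1.trans ?_
    rw [div_mul_eq_mul_div]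
    gcongr
    exact sub_le_self _ (Nat.cast_nonneg _)
  have hlim : Filter.Tendsto (fun n : ℕ => (s * ((∑ u, S 0 u : ℕ) : ℝ)) / (n + 1 : ℕ))
      Filter.atTop (nhds 0) :=
    (tendsto_const_div_atTop_nhds_zero_nat _).comp (Filter.tendsto_add_atTop_nat 1)
  have := ge_of_tendsto' hlim hbound
  linarith

/-- `L♮`-convexity of the indirect utility. -/
theorem indirectUtility_sup_add_inf_translate_le (h : SatisfiesSubstitutes (fun _ : U => 1) w)
    (p q : U → ℝ) {α : ℝ} (hα : 0 ≤ α) :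
    indirectUtility (fun _ => 1) w ((p - fun _ => α) ⊔ q) +
        indirectUtility (fun _ => 1) w (p ⊓ (q + fun _ => α)) ≤
      indirectUtility (fun _ => 1) w p + indirectUtility (fun _ => 1) w q := by
  -- Submodularity produces the join `p ⊔ (q + α)`; this is `(p - α) ⊔ q` raised by `α`, and `h2`
  -- trades that rise for the one from `q` to `q + α`.
  have h1 := indirectUtility_inf_add_sup_le h p (q + fun _ => α)
  have h2 := indirectUtility_add_const_le h (p := q) (q := (p - fun _ => α) ⊔ q)
    le_sup_right hα
  have h3 : ((p - fun _ => α) ⊔ q) + (fun _ => α) = p ⊔ (q + fun _ => α) := by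
    rw [sup_add, sub_add_cancel]
  rw [h3] at h2
  linarith

end Substitutes

/-! ### Sizes of preferred bundles and the multiplier of a size bound -/

section Sizes

variable {U : Type*} [Fintype U] {w : (U → ℕ) → ℕ}

/-- Prices can be perturbed so that the preferred bundles are the formerly preferred bundles that
lie between `S ⊓ T` and `S ⊔ T`, where `S` and `T` are given preferred bundles. -/
theorem exists_demandSet_between {q : U → ℝ} {S T : U → ℕ}
    (hS : S ∈ demandSet (fun _ => 1) w q) (hT : T ∈ demandSet (fun _ => 1) w q) :
    ∃ r : U → ℝ, S ∈ demandSet (fun _ => 1) w r ∧ T ∈ demandSet (fun _ => 1) w r ∧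
      ∀ Z ∈ demandSet (fun _ => 1) w r, Z ∈ demandSet (fun _ => 1) w q ∧
        ∀ u, S u = T u → Z u = S u := by
  -- Units in neither bundle become dearer and units in both cheaper, which penalises any deviation
  -- from the common part of `S` and `T`.
  set x : U → ℝ := fun u => if S u = T u then 1 - 2 * S u else 0 with hx
  have hev := eventually_demandSet_add_smul_subset (fun _ => 1) w q x
  obtain ⟨ε, hsub, hε⟩ : ∃ ε : ℝ, demandSet (fun _ => 1) w (q + ε • x) ⊆
      demandSet (fun _ => 1) w q ∧ 0 < ε :=
    ((hev.filter_mono nhdsWithin_le_nhds).and (self_mem_nhdsWithin (s := Set.Ioi 0))).exists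
  have hut : ∀ z : U → ℕ, utility w (q + ε • x) z =
      utility w q z - ε * ∑ u, x u * (z u : ℝ) := by
    intro z
    rw [utility_add, Finset.mul_sum]
    simp only [Pi.smul_apply, smul_eq_mul, mul_assoc]
  have hterm : ∀ z : U → ℕ, z ≤ (fun _ => 1) → ∀ u, x u * (S u : ℝ) ≤ x u * (z u : ℝ) ∧
      (S u = T u → x u * (z u : ℝ) ≤ x u * (S u : ℝ) → z u = S u) := by
    intro z hz u
    have h1 : z u ≤ 1 := hz u
    have h2 : S u ≤ 1 := hS.1 u
    by_cases h : S u = T u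
    · simp only [hx, if_pos h]
      generalize S u = a at *
      generalize z u = c at *
      interval_cases a <;> interval_cases c <;> norm_num
    · simp [hx, h]
  have hST : ∑ u, x u * (T u : ℝ) = ∑ u, x u * (S u : ℝ) := by
    refine Finset.sum_congr rfl fun u _ => ?_
    by_cases h : S u = T u
    · rw [h]
    · simp [hx, h]
  have hle : ∀ z : U → ℕ, z ≤ (fun _ => 1) →
      ∑ u, x u * (S u : ℝ) ≤ ∑ u, x u * (z u : ℝ) :=
    fun z hz => Finset.sum_le_sum fun u _ => (hterm z hz u).1
  have hSmem : S ∈ demandSet (fun _ => 1) w (q + ε • x) := by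
    refine ⟨hS.1, fun y hy => ?_⟩
    rw [hut, hut]
    have := mul_le_mul_of_nonneg_left (hle y hy) hε.le
    linarith [hS.2 y hy]
  have hTmem : T ∈ demandSet (fun _ => 1) w (q + ε • x) := by
    refine ⟨hT.1, fun y hy => ?_⟩
    rw [hut, hut, hST]
    have := mul_le_mul_of_nonneg_left (hle y hy) hε.le
    linarith [hT.2 y hy]
  refine ⟨_, hSmem, hTmem, fun Z hZ => ⟨hsub hZ, fun u hu => ?_⟩⟩
  have h1 := hZ.2 S hS.1
  rw [hut, hut] at h1
  have h2 := hS.2 Z hZ.1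
  have h3 : ∑ u, x u * (Z u : ℝ) ≤ ∑ u, x u * (S u : ℝ) :=
    le_of_mul_le_mul_left (by linarith) hε
  have h4 := (Finset.sum_eq_sum_iff_of_le fun u _ => (hterm Z hZ.1 u).1).1
    (le_antisymm (hle Z hZ.1) h3) u (Finset.mem_univ u)
  exact (hterm Z hZ.1 u).2 hu h4.ge

/-- If exactly two bundles are preferred, then their sizes differ by at most one. -/
theorem sum_le_sum_add_one_of_demandSet_subset_pair
    (h : SatisfiesSubstitutes (fun _ : U => 1) w) {r : U → ℝ} {S T : U → ℕ}
    (hS : S ∈ demandSet (fun _ => 1) w r) (hT : T ∈ demandSet (fun _ => 1) w r)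
    (hpair : ∀ Z ∈ demandSet (fun _ => 1) w r, Z = S ∨ Z = T) :
    ∑ u, S u ≤ ∑ u, T u + 1 := by
  classical
  by_contra! hlt
  obtain ⟨j, -, hj⟩ := Finset.exists_lt_of_sum_lt (lt_of_le_of_lt (Nat.le_succ _) hlt)
  have hSj : S j ≤ 1 := hS.1 j
  have hTj : T j = 0 := by lia
  -- Since `T` avoids `j`, it keeps its utility when `j` becomes dearer. So `Y` must avoid `j` and
  -- be preferred at `r`, hence `Y = T`; and `Y` contains `S` without `j`.
  obtain ⟨Y, hY, hSY, -⟩ := h r (r + Pi.single j 1)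
    (le_add_of_nonneg_right (Pi.single_nonneg.2 zero_le_one)) S hS
  have h1 := hY.2 T hT.1
  rw [utility_add_single, utility_add_single, hTj] at h1
  have h2 := hT.2 Y hY.1
  have hYj : Y j = 0 := by
    have : (Y j : ℝ) ≤ 0 := by
      push_cast at h1
      linarith
    exact_mod_cast le_antisymm this (Nat.cast_nonneg _)
  rw [hYj] at h1
  have hYr : Y ∈ demandSet (fun _ => 1) w r :=
    ⟨hY.1, fun y hy => (hT.2 y hy).trans (by push_cast at h1; linarith)⟩
  rcases hpair Y hYr with rfl | rfl
  · lia
  · have : ∑ u, S u ≤ ∑ u, (Y u + Pi.single (M := fun _ => ℕ) j 1 u) := by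
      refine Finset.sum_le_sum fun u _ => ?_
      by_cases hu : u = j
      · subst hu
        simpa [hYj] using hSj
      · simpa [hu] using hSY u (by simp [hu])
    rw [Finset.sum_add_distrib] at this
    simp at this
    lia

/-- Under gross substitutes, the sizes of the preferred bundles form an interval. -/
theorem exists_mem_demandSet_sum_eq (h : SatisfiesSubstitutes (fun _ : U => 1) w)
    {q : U → ℝ} {d : ℕ} {S T : U → ℕ}
    (hS : S ∈ demandSet (fun _ => 1) w q) (hT : T ∈ demandSet (fun _ => 1) w q)
    (hTd : ∑ u, T u ≤ d) (hdS : d ≤ ∑ u, S u) :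
    ∃ Z ∈ demandSet (fun _ => 1) w q, ∑ u, Z u = d := by
  induction hn : (Finset.univ.filter fun u => S u ≠ T u).card using Nat.strong_induction_on
    generalizing S T with
  | _ n ih =>
    subst hn
    rcases hTd.eq_or_lt with hTd' | hTd'
    · exact ⟨T, hT, hTd'⟩
    rcases hdS.eq_or_lt with hdS' | hdS'
    · exact ⟨S, hS, hdS'.symm⟩
    -- With `d` strictly between the two sizes, `S` and `T` cannot be the only preferred bundles at
    -- `r`. A third one lies between them and replaces one of them, shrinking their symmetric
    -- difference.
    obtain ⟨r, hSr, hTr, hr⟩ := exists_demandSet_between hS hT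
    by_cases hpair : ∀ Z ∈ demandSet (fun _ => 1) w r, Z = S ∨ Z = T
    · have := sum_le_sum_add_one_of_demandSet_subset_pair h hSr hTr hpair
      lia
    · push Not at hpair
      obtain ⟨Z, hZr, hZS, hZT⟩ := hpair
      obtain ⟨hZ, hagree⟩ := hr Z hZr
      have hbetween : ∀ u, (Z u ≠ T u → S u ≠ T u) ∧ (S u ≠ Z u → S u ≠ T u) ∧
          (Z u ≠ S u → S u ≠ T u ∧ Z u = T u) ∧ (Z u ≠ T u → S u ≠ T u ∧ S u = Z u) := by
        intro u
        have h1 : Z u ≤ 1 := hZ.1 u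
        have h2 : S u ≤ 1 := hS.1 u
        have h3 : T u ≤ 1 := hT.1 u
        have h4 := hagree u
        lia
      rcases le_total d (∑ u, Z u) with hd | hd
      · refine ih _ (Finset.card_lt_card ?_) hZ hT hTd hd rfl
        obtain ⟨u, hu⟩ := Function.ne_iff.1 hZS
        exact Finset.ssubset_iff_of_subset (fun a => by simpa using (hbetween a).1)
          |>.2 ⟨u, by simpa using (hbetween u).2.2.1 hu⟩
      · refine ih _ (Finset.card_lt_card ?_) hS hZ hd hdS rfl
        obtain ⟨u, hu⟩ := Function.ne_iff.1 hZT
        exact Finset.ssubset_iff_of_subset (fun a => by simpa using (hbetween a).2.1)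
          |>.2 ⟨u, by simpa using (hbetween u).2.2.2 hu⟩

/-- A bound `d` on the size of bundles has a supporting uniform price rise `t`. -/
theorem exists_supporting_price_rise (h : SatisfiesSubstitutes (fun _ : U => 1) w)
    (p : U → ℝ) (d : ℕ) :
    ∃ t : ℝ, 0 ≤ t ∧ ∃ Z ∈ demandSet (fun _ => 1) w (p + fun _ => t),
      ∑ u, Z u ≤ d ∧ t * (∑ u, Z u : ℕ) = t * d := by
  classical
  -- The multiplier is the least uniform rise at which some preferred bundle has size at most `d`.
  -- If it is positive, bundles preferred just below it are larger than `d` and remain preferred at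
  -- it, so size exactly `d` occurs there.
  set A : Set ℝ := {t | 0 ≤ t ∧ ∃ Z ∈ demandSet (fun _ => 1) w (p + fun _ => t),
    ∑ u, Z u ≤ d} with hA
  have hc : ∀ x : U → ℕ, Continuous fun t : ℝ => utility w (p + fun _ => t) x := by
    intro x
    simp only [utility_add_const]
    fun_prop
  have hclosed : IsClosed A := by
    have : A = Set.Ici 0 ∩ ⋃ Z ∈ {Z : U → ℕ | Z ≤ (fun _ => 1) ∧ ∑ u, Z u ≤ d},
        ⋂ y ∈ {y : U → ℕ | y ≤ fun _ => 1},
          {t : ℝ | utility w (p + fun _ => t) y ≤ utility w (p + fun _ => t) Z} := by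
      ext t
      simp only [hA, demandSet, Set.mem_inter_iff, Set.mem_Ici, Set.mem_iUnion, Set.mem_iInter,
        Set.mem_ofPred_eq, exists_prop]
      constructor
      · rintro ⟨ht, Z, ⟨h1, h2⟩, h3⟩
        exact ⟨ht, Z, ⟨h1, h3⟩, h2⟩
      · rintro ⟨ht, Z, ⟨h1, h3⟩, h2⟩
        exact ⟨ht, Z, ⟨h1, h2⟩, h3⟩
    rw [this]
    refine isClosed_Ici.inter (Set.Finite.isClosed_biUnion ?_ fun Z _ => ?_)
    · exact (Set.finite_Iic fun _ : U => 1).subset fun Z hZ => hZ.1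
    · exact isClosed_biInter fun y _ => isClosed_le (hc y) (hc Z)
  have hne : A.Nonempty := by
    have key : ∀ y ∈ Finset.Iic (fun _ : U => 1), ∀ᶠ t : ℝ in Filter.atTop,
        utility w (p + fun _ => t) y ≤ utility w (p + fun _ => t) 0 := by
      intro y _
      filter_upwards [Filter.eventually_ge_atTop (0 : ℝ),
        Filter.eventually_ge_atTop (utility w p y - utility w p 0)] with t ht0 ht
      rw [utility_add_const, utility_add_const]
      rcases Nat.eq_zero_or_pos (∑ u, y u) with h0 | h0
      · have : y = 0 := by
          funext u
          exact Finset.sum_eq_zero_iff.1 h0 u (Finset.mem_univ u)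
        rw [this]
      · have h1 : (1 : ℝ) ≤ (∑ u, y u : ℕ) := by exact_mod_cast h0
        have := mul_le_mul_of_nonneg_left h1 ht0
        simp only [Pi.zero_apply, Finset.sum_const_zero, Nat.cast_zero, mul_zero, sub_zero]
        linarith
    obtain ⟨t, ht, ht0⟩ := (((Finset.eventually_all _).2 key).and
      (Filter.eventually_ge_atTop (0 : ℝ))).exists
    exact ⟨t, ht0, 0, ⟨fun _ => zero_le_one, fun y hy => ht y (by simpa using hy)⟩, by simp⟩
  have hbdd : BddBelow A := ⟨0, fun t ht => ht.1⟩
  obtain ⟨ht0, T, hT, hTd⟩ := hclosed.csInf_mem hne hbdd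
  set t := sInf A with ht
  rcases ht0.eq_or_lt with h0 | h0
  · exact ⟨t, ht0, T, hT, hTd, by rw [← h0, zero_mul, zero_mul]⟩
  have hev := eventually_demandSet_add_smul_subset (fun _ => 1) w (p + fun _ => t)
    (fun _ => (-1 : ℝ))
  obtain ⟨ε, ⟨hsub, hεt⟩, hε⟩ : ∃ ε : ℝ, (demandSet (fun _ => 1) w
      ((p + fun _ => t) + ε • fun _ => (-1 : ℝ)) ⊆
      demandSet (fun _ => 1) w (p + fun _ => t) ∧ ε < t) ∧ 0 < ε :=
    (((hev.and (eventually_lt_nhds h0)).filter_mono nhdsWithin_le_nhds).and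
      (self_mem_nhdsWithin (s := Set.Ioi 0))).exists
  have heq : ((p + fun _ => t) + ε • fun _ => (-1 : ℝ)) = p + fun _ => t - ε := by
    funext u
    simp
    ring
  rw [heq] at hsub
  obtain ⟨S, hS⟩ := exists_mem_demandSet (fun _ => 1) w (p + fun _ => t - ε)
  have hdS : d ≤ ∑ u, S u := by
    by_contra! hlt
    have : t ≤ t - ε := csInf_le hbdd ⟨by linarith, S, hS, hlt.le⟩
    linarith
  obtain ⟨Z, hZ, hZd⟩ := exists_mem_demandSet_sum_eq h (hsub hS) hT hTd hdS
  exact ⟨t, ht0, Z, hZ, hZd.le, by rw [hZd]⟩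

end Sizes

/-! ### Walrasian prices as minimisers of the Lyapunov function -/

section Lyapunov

variable {E N : Type*} [Fintype E] [Fintype N]

/-- The Lyapunov function of the market: total indirect utility plus the value of the supply. -/
noncomputable def lyapunov (b : E → ℕ) (v : N → (E → ℕ) → ℕ) (p : E → ℝ) : ℝ :=
  ∑ i, indirectUtility b (v i) p + ∑ e, p e * (b e : ℝ)

/-- When the market clears, the buyers' payments equal the value of the supply, so prices cancel and
only welfare remains. -/
theorem sum_utility_add_supply {b : E → ℕ} (v : N → (E → ℕ) → ℕ) (p : E → ℝ) {z : N → E → ℕ}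
    (hz : ∀ e, ∑ i, z i e = b e) :
    ∑ i, utility (v i) p (z i) + ∑ e, p e * (b e : ℝ) = ∑ i, (v i (z i) : ℝ) := by
  have : ∑ e, p e * (b e : ℝ) = ∑ i, ∑ e, p e * (z i e : ℝ) := by
    rw [Finset.sum_comm]
    refine Finset.sum_congr rfl fun e _ => ?_
    rw [← hz e, Nat.cast_sum, Finset.mul_sum]
  simp only [utility, Finset.sum_sub_distrib]
  linarith

theorem IsWalrasian.lyapunov_le {b : E → ℕ} {v : N → (E → ℕ) → ℕ} {p : E → ℝ}
    (hp : IsWalrasian b v p) (q : E → ℝ) : lyapunov b v p ≤ lyapunov b v q := by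
  obtain ⟨-, z, hz, hzb⟩ := hp
  have h1 := sum_utility_add_supply v p hzb
  have h2 := sum_utility_add_supply v q hzb
  have h3 : ∑ i, utility (v i) p (z i) = ∑ i, indirectUtility b (v i) p :=
    Finset.sum_congr rfl fun i _ => utility_eq_of_mem_demandSet (hz i)
  have h4 : ∑ i, utility (v i) q (z i) ≤ ∑ i, indirectUtility b (v i) q :=
    Finset.sum_le_sum fun i _ => utility_le_indirectUtility (hz i).1 q
  unfold lyapunov
  linarith

/-- The allocation supporting `p` also supports `q`: each buyer's utility at `q` is at most the
indirect utility, and the totals agree, so there is equality for every buyer. -/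
theorem IsWalrasian.of_lyapunov_le {b : E → ℕ} {v : N → (E → ℕ) → ℕ} {p q : E → ℝ}
    (hp : IsWalrasian b v p) (hq : ∀ e, 0 ≤ q e) (h : lyapunov b v q ≤ lyapunov b v p) :
    IsWalrasian b v q := by
  obtain ⟨-, z, hz, hzb⟩ := hp
  refine ⟨hq, z, fun i => ?_, hzb⟩
  have h1 := sum_utility_add_supply v p hzb
  have h2 := sum_utility_add_supply v q hzb
  have h3 : ∑ i, utility (v i) p (z i) = ∑ i, indirectUtility b (v i) p :=
    Finset.sum_congr rfl fun i _ => utility_eq_of_mem_demandSet (hz i)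
  have h4 : ∀ i ∈ Finset.univ, utility (v i) q (z i) ≤ indirectUtility b (v i) q :=
    fun i _ => utility_le_indirectUtility (hz i).1 q
  unfold lyapunov at h
  have h5 := (Finset.sum_eq_sum_iff_of_le h4).1
    (le_antisymm (Finset.sum_le_sum h4) (by linarith)) i (Finset.mem_univ i)
  exact mem_demandSet_of_indirectUtility_le (hz i).1 h5.ge

/-- Monotone comparative statics: an exchange inequality between two markets puts the meet
and the join of their Walrasian price vectors again into the respective Walrasian sets. -/
theorem IsWalrasian.of_lyapunov_add_le {E' N' : Type*} [Fintype E'] [Fintype N'] {b : E → ℕ}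
    {v : N → (E → ℕ) → ℕ} {b' : E' → ℕ} {v' : N' → (E' → ℕ) → ℕ} {p r : E → ℝ} {p' r' : E' → ℝ}
    (hp : IsWalrasian b v p) (hp' : IsWalrasian b' v' p') (hr : ∀ e, 0 ≤ r e)
    (hr' : ∀ e, 0 ≤ r' e)
    (h : lyapunov b v r + lyapunov b' v' r' ≤ lyapunov b v p + lyapunov b' v' p') :
    IsWalrasian b v r ∧ IsWalrasian b' v' r' :=
  ⟨hp.of_lyapunov_le hr (by linarith [hp'.lyapunov_le r']),
    hp'.of_lyapunov_le hr' (by linarith [hp.lyapunov_le r])⟩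

theorem IsWalrasian.inf {v : N → (E → ℕ) → ℕ}
    (h : ∀ i, SatisfiesSubstitutes (fun _ => 1) (v i)) {p q : E → ℝ}
    (hp : IsWalrasian (fun _ => 1) v p) (hq : IsWalrasian (fun _ => 1) v q) :
    IsWalrasian (fun _ => 1) v (p ⊓ q) := by
  refine (hp.of_lyapunov_add_le hq (r := p ⊓ q) (r' := p ⊔ q) (fun e => le_inf (hp.1 e) (hq.1 e))
    (fun e => le_sup_of_le_left (hp.1 e)) ?_).1
  have h1 := Finset.sum_le_sum fun i (_ : i ∈ Finset.univ) =>
    indirectUtility_inf_add_sup_le (h i) p q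
  have h2 : ∑ e, (p ⊓ q) e * (((1 : ℕ) : ℝ)) + ∑ e, (p ⊔ q) e * (((1 : ℕ) : ℝ)) =
      ∑ e, p e * (((1 : ℕ) : ℝ)) + ∑ e, q e * (((1 : ℕ) : ℝ)) := by
    rw [← Finset.sum_add_distrib, ← Finset.sum_add_distrib]
    refine Finset.sum_congr rfl fun e _ => ?_
    simp
  simp only [Finset.sum_add_distrib] at h1
  unfold lyapunov
  linarith

end Lyapunov

/-! ### Passing between items and individual units -/

section Units

variable {E : Type*}

/-- The number of units of each item in a bundle of units. -/
def countUnits {b : E → ℕ} (S : (Σ e : E, Fin (b e)) → ℕ) : E → ℕ :=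
  fun e => ∑ k : Fin (b e), S ⟨e, k⟩

theorem unitValuation_apply (b : E → ℕ) (v : (E → ℕ) → ℕ) (S : (Σ e : E, Fin (b e)) → ℕ) :
    unitValuation b v S = v (countUnits S) := rfl

theorem countUnits_le {b : E → ℕ} {S : (Σ e : E, Fin (b e)) → ℕ} (hS : S ≤ fun _ => 1) :
    countUnits S ≤ b := by
  intro e
  refine (Finset.sum_le_sum fun k _ => hS ⟨e, k⟩).trans ?_
  simp

/-- The bundle of units that consists of the first `z e` units of each item `e`. -/
def firstUnits (b z : E → ℕ) : (Σ e : E, Fin (b e)) → ℕ :=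
  fun u => if u.2.val < z u.1 then 1 else 0

theorem firstUnits_le (b z : E → ℕ) : firstUnits b z ≤ fun _ => 1 := by
  intro u
  unfold firstUnits
  split_ifs <;> simp

theorem countUnits_firstUnits {b z : E → ℕ} (hz : z ≤ b) : countUnits (firstUnits b z) = z := by
  funext e
  simp only [countUnits, firstUnits]
  rw [Fin.sum_univ_eq_sum_range (fun k => if k < z e then 1 else 0) (b e), Finset.sum_boole]
  have : (Finset.range (b e)).filter (fun k => k < z e) = Finset.range (z e) := by
    ext k
    have := hz e
    simp only [Finset.mem_filter, Finset.mem_range]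
    lia
  simp [this]

variable [Fintype E]

theorem sum_countUnits {b : E → ℕ} (S : (Σ e : E, Fin (b e)) → ℕ) :
    ∑ e, countUnits S e = ∑ u, S u := by
  rw [Fintype.sum_sigma]
  rfl

theorem utility_unitValuation (b : E → ℕ) (v : (E → ℕ) → ℕ) (p : E → ℝ)
    (S : (Σ e : E, Fin (b e)) → ℕ) :
    utility (unitValuation b v) (fun u => p u.1) S = utility v p (countUnits S) := by
  unfold utility
  rw [unitValuation_apply, Fintype.sum_sigma]
  congr 1
  refine Finset.sum_congr rfl fun e _ => ?_
  simp only [countUnits, Nat.cast_sum, Finset.mul_sum]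

theorem indirectUtility_unitValuation (b : E → ℕ) (v : (E → ℕ) → ℕ) (p : E → ℝ) :
    indirectUtility (fun _ => 1) (unitValuation b v) (fun u => p u.1) =
      indirectUtility b v p := by
  apply le_antisymm
  · refine indirectUtility_le fun S hS => ?_
    rw [utility_unitValuation]
    exact utility_le_indirectUtility (countUnits_le hS) p
  · refine indirectUtility_le fun z hz => ?_
    have := utility_le_indirectUtility (v := unitValuation b v) (firstUnits_le b z)
      (fun u => p u.1)
    rwa [utility_unitValuation, countUnits_firstUnits hz] at this

/-- Meets, joins and uniform translations of prices that are constant on the units of each item are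
again constant there, so the inequality for units descends to items. -/
theorem indirectUtility_multiunit_sup_add_inf_le {b : E → ℕ} {v : (E → ℕ) → ℕ}
    (h : IsStrongGrossSubstitutes b v) (p q : E → ℝ) {α : ℝ} (hα : 0 ≤ α) :
    indirectUtility b v ((p - fun _ => α) ⊔ q) + indirectUtility b v (p ⊓ (q + fun _ => α)) ≤
      indirectUtility b v p + indirectUtility b v q := by
  simp only [← indirectUtility_unitValuation b v]
  exact indirectUtility_sup_add_inf_translate_le h _ _ hα

/-- Nonnegative prices are Walrasian if and only if the corresponding prices of the individual units
are Walrasian. -/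
theorem isWalrasian_unitValuation_iff {N : Type*} [Fintype N] {b : E → ℕ}
    {v : N → (E → ℕ) → ℕ} {p : E → ℝ} (hp : ∀ e, 0 ≤ p e) :
    IsWalrasian (fun _ => 1) (fun i => unitValuation b (v i)) (fun u => p u.1) ↔
      IsWalrasian b v p := by
  classical
  constructor
  · rintro ⟨-, S, hS, hSb⟩
    refine ⟨hp, fun i => countUnits (S i), fun i => ?_, fun e => ?_⟩
    · refine mem_demandSet_of_indirectUtility_le (countUnits_le (hS i).1) ?_
      rw [← utility_unitValuation, utility_eq_of_mem_demandSet (hS i),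
        indirectUtility_unitValuation]
    · simp only [countUnits]
      rw [Finset.sum_comm]
      simp [hSb]
  · rintro ⟨-, z, hz, hzb⟩
    -- Market clearing lets the units of `e` be dealt out so that buyer `i` gets `z i e` of them.
    have hcard : ∀ e, Nonempty (Fin (b e) ≃ Σ i, Fin (z i e)) := by
      intro e
      exact ⟨Fintype.equivOfCardEq (by simp [hzb])⟩
    let φ : ∀ e, Fin (b e) ≃ Σ i, Fin (z i e) := fun e => (hcard e).some
    set S : N → (Σ e : E, Fin (b e)) → ℕ := fun i u => if (φ u.1 u.2).1 = i then 1 else 0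
      with hSdef
    have hS1 : ∀ i, S i ≤ fun _ => 1 := by
      intro i u
      simp only [hSdef]
      split_ifs <;> simp
    have hcount : ∀ i, countUnits (S i) = z i := by
      intro i
      funext e
      simp only [countUnits, hSdef]
      rw [Equiv.sum_comp (φ e) (fun x : Σ j, Fin (z j e) => if x.1 = i then 1 else 0),
        Fintype.sum_sigma, Finset.sum_eq_single i]
      · simp
      · intro j _ hj
        simp [hj]
      · simp
    refine ⟨fun u => hp u.1, S, fun i => ?_, fun u => ?_⟩
    · refine mem_demandSet_of_indirectUtility_le (hS1 i) ?_
      rw [utility_unitValuation, indirectUtility_unitValuation, hcount,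
        utility_eq_of_mem_demandSet (hz i)]
    · simp [hSdef]

/-- Units of the same item are interchangeable. -/
theorem IsWalrasian.comp_swap [DecidableEq E] {N : Type*} [Fintype N] {b : E → ℕ}
    {v : N → (E → ℕ) → ℕ} {Q : (Σ e : E, Fin (b e)) → ℝ}
    (hQ : IsWalrasian (fun _ => 1) (fun i => unitValuation b (v i)) Q)
    {x y : Σ e : E, Fin (b e)} (hxy : x.1 = y.1) :
    IsWalrasian (fun _ => 1) (fun i => unitValuation b (v i)) (Q ∘ Equiv.swap x y) := by
  have hfst : ∀ u, (Equiv.swap x y u).1 = u.1 := by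
    intro u
    rw [Equiv.swap_apply_def]
    split_ifs with h1 h2
    · rw [h1, hxy]
    · rw [h2, hxy]
    · rfl
  set σ := Equiv.swap x y with hσ
  have hcount : ∀ S : (Σ e : E, Fin (b e)) → ℕ, countUnits (S ∘ σ) = countUnits S := by
    intro S
    funext e
    have h1 : ∀ T : (Σ e : E, Fin (b e)) → ℕ,
        countUnits T e = ∑ u, if u.1 = e then T u else 0 := by
      intro T
      rw [Fintype.sum_sigma, Finset.sum_eq_single e]
      · simp [countUnits]
      · intro a _ ha
        simp [ha]
      · simp
    rw [h1, h1, ← Equiv.sum_comp σ fun u => if u.1 = e then S u else 0]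
    simp only [hfst, Function.comp_apply]
  have hu : ∀ i (S : (Σ e : E, Fin (b e)) → ℕ),
      utility (unitValuation b (v i)) (Q ∘ σ) (S ∘ σ) = utility (unitValuation b (v i)) Q S := by
    intro i S
    unfold utility
    rw [unitValuation_apply, unitValuation_apply, hcount]
    congr 1
    exact Equiv.sum_comp σ fun u => Q u * (S u : ℝ)
  obtain ⟨h0, S, hS, hSb⟩ := hQ
  refine ⟨fun u => h0 _, fun i => S i ∘ σ, fun i => ⟨fun u => (hS i).1 _, fun y hy => ?_⟩,
    fun u => hSb _⟩
  have h1 : y = (y ∘ σ) ∘ σ := by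
    funext u
    simp [hσ]
  rw [h1, hu, hu]
  exact (hS i).2 _ fun u => hy _

end Units

/-! ### Truncated demand by Lagrangian duality -/

section Demand

variable {E : Type*} [Fintype E] [DecidableEq E]

theorem le_truncation (v : (E → ℕ) → ℕ) {d : ℕ} {z : E → ℕ} (hz : ∑ e, z e ≤ d) :
    v z ≤ truncation v d z :=
  Finset.le_sup (f := v) (by simpa using hz)

theorem exists_truncation_eq (v : (E → ℕ) → ℕ) (d : ℕ) (z : E → ℕ) :
    ∃ y ≤ z, ∑ e, y e ≤ d ∧ truncation v d z = v y := by
  obtain ⟨y, hy, hyz⟩ := Finset.exists_mem_eq_sup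
    ((Finset.Iic z).filter fun y => ∑ e, y e ≤ d) ⟨0, by simp⟩ v
  simp only [Finset.mem_filter, Finset.mem_Iic] at hy
  exact ⟨y, hy.1, hy.2, hyz⟩

/-- The indirect utility of a truncated valuation is bounded by the Lagrangian relaxation. -/
theorem indirectUtility_truncation_le (b : E → ℕ) (v : (E → ℕ) → ℕ) (d : ℕ) {p : E → ℝ}
    (hp : ∀ e, 0 ≤ p e) {t : ℝ} (ht : 0 ≤ t) :
    indirectUtility b (truncation v d) p ≤ indirectUtility b v (p + fun _ => t) + t * d := by
  refine indirectUtility_le fun z hz => ?_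
  obtain ⟨y, hyz, hyd, hy⟩ := exists_truncation_eq v d z
  have h1 := utility_le_indirectUtility (v := v) (hyz.trans hz) (p + fun _ => t)
  rw [utility_add_const] at h1
  have h2 : t * (∑ e, y e : ℕ) ≤ t * d :=
    mul_le_mul_of_nonneg_left (by exact_mod_cast hyd) ht
  -- Nonnegative prices enter here: discarding the units of `z` outside `y` does not raise the
  -- payment.
  have h3 : utility (truncation v d) p z ≤ utility v p y := by
    unfold utility
    rw [hy]
    gcongr with e
    · exact hp e
    · exact hyz e
  linarith

/-- For a strong gross substitutes valuation the Lagrangian relaxation is exact. -/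
theorem exists_indirectUtility_add_le_truncation {b : E → ℕ} {v : (E → ℕ) → ℕ}
    (h : IsStrongGrossSubstitutes b v) (d : ℕ) (p : E → ℝ) :
    ∃ t : ℝ, 0 ≤ t ∧
      indirectUtility b v (p + fun _ => t) + t * d ≤ indirectUtility b (truncation v d) p := by
  obtain ⟨t, ht, Z, hZ, hZd, htZ⟩ := exists_supporting_price_rise h (fun u => p u.1) d
  refine ⟨t, ht, ?_⟩
  have h1 : ((fun u : Σ e : E, Fin (b e) => p u.1) + fun _ => t) =
      fun u => (p + fun _ => t : E → ℝ) u.1 := rfl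
  rw [h1] at hZ
  have h2 := utility_eq_of_mem_demandSet hZ
  rw [utility_unitValuation, indirectUtility_unitValuation, utility_add_const,
    sum_countUnits, htZ] at h2
  have h3 := utility_le_indirectUtility (v := truncation v d) (countUnits_le hZ.1) p
  have h4 : utility v p (countUnits Z) ≤ utility (truncation v d) p (countUnits Z) := by
    unfold utility
    gcongr
    exact le_truncation v (by rwa [sum_countUnits])
  linarith

/-- Exchange inequality for two truncations of a strong gross substitutes valuation. -/
theorem indirectUtility_truncation_sup_add_inf_le {b : E → ℕ} {v : (E → ℕ) → ℕ}
    (h : IsStrongGrossSubstitutes b v) {d d' : ℕ} (hd : d' ≤ d) {p p' : E → ℝ}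
    (hp : ∀ e, 0 ≤ p e) (hp' : ∀ e, 0 ≤ p' e) :
    indirectUtility b (truncation v d) (p ⊔ p') + indirectUtility b (truncation v d') (p ⊓ p') ≤
      indirectUtility b (truncation v d) p + indirectUtility b (truncation v d') p' := by
  obtain ⟨t, ht, h1⟩ := exists_indirectUtility_add_le_truncation h d p
  obtain ⟨t', ht', h2⟩ := exists_indirectUtility_add_le_truncation h d' p'
  have hsup : ∀ e, 0 ≤ (p ⊔ p') e := fun e => le_sup_of_le_left (hp e)
  have hinf : ∀ e, 0 ≤ (p ⊓ p') e := fun e => le_inf (hp e) (hp' e)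
  rcases le_total t t' with htt | htt
  -- The shift `t' - t` keeps multiplier `t` with the join and `t'` with the meet, so the terms `t
  -- d` and `t' d'` match.
  · have h3 := indirectUtility_multiunit_sup_add_inf_le h (p' + fun _ => t') (p + fun _ => t)
      (sub_nonneg.2 htt)
    have e1 : ((p' + fun _ => t') - fun _ => t' - t) ⊔ (p + fun _ => t) =
        (p ⊔ p') + fun _ => t := by
      rw [sup_add, sup_comm]
      congr 1
      funext e
      simp only [Pi.sub_apply, Pi.add_apply]
      ring
    have e2 : (p' + fun _ => t') ⊓ ((p + fun _ => t) + fun _ => t' - t) =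
        (p ⊓ p') + fun _ => t' := by
      rw [inf_add, inf_comm]
      congr 1
      funext e
      simp
    rw [e1, e2] at h3
    have h4 := indirectUtility_truncation_le b v d hsup ht
    have h5 := indirectUtility_truncation_le b v d' hinf ht'
    linarith
  -- Here the multipliers are exchanged: the join gets `t'` and the meet `t`. This costs nothing
  -- since `(t - t')(d - d') ≥ 0`.
  · have h3 := indirectUtility_multiunit_sup_add_inf_le h (p + fun _ => t) (p' + fun _ => t')
      (sub_nonneg.2 htt)
    have e1 : ((p + fun _ => t) - fun _ => t - t') ⊔ (p' + fun _ => t') =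
        (p ⊔ p') + fun _ => t' := by
      rw [sup_add]
      congr 1
      funext e
      simp only [Pi.sub_apply, Pi.add_apply]
      ring
    have e2 : (p + fun _ => t) ⊓ ((p' + fun _ => t') + fun _ => t - t') =
        (p ⊓ p') + fun _ => t := by
      rw [inf_add]
      congr 1
      funext e
      simp
    rw [e1, e2] at h3
    have h4 := indirectUtility_truncation_le b v d hsup ht'
    have h5 := indirectUtility_truncation_le b v d' hinf ht
    have hdr : (d' : ℝ) ≤ d := by exact_mod_cast hd
    nlinarith [mul_nonneg (sub_nonneg.2 htt) (sub_nonneg.2 hdr)]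

theorem isWalrasian_truncation_sup_inf {N : Type*} [Fintype N] {b : E → ℕ}
    {v : N → (E → ℕ) → ℕ} (h : ∀ i, IsStrongGrossSubstitutes b (v i)) {d d' : N → ℕ}
    (hd : d' ≤ d) {p p' : E → ℝ} (hp : IsWalrasian b (fun i => truncation (v i) (d i)) p)
    (hp' : IsWalrasian b (fun i => truncation (v i) (d' i)) p') :
    IsWalrasian b (fun i => truncation (v i) (d i)) (p ⊔ p') ∧
      IsWalrasian b (fun i => truncation (v i) (d' i)) (p ⊓ p') := by
  refine hp.of_lyapunov_add_le hp' (r := p ⊔ p') (r' := p ⊓ p') (fun e => le_sup_of_le_left (hp.1 e))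
    (fun e => le_inf (hp.1 e) (hp'.1 e)) ?_
  have h1 := Finset.sum_le_sum fun i (_ : i ∈ Finset.univ) =>
    indirectUtility_truncation_sup_add_inf_le (h i) (hd i) hp.1 hp'.1
  have h2 : ∑ e, (p ⊔ p') e * (b e : ℝ) + ∑ e, (p ⊓ p') e * (b e : ℝ) =
      ∑ e, p e * (b e : ℝ) + ∑ e, p' e * (b e : ℝ) := by
    simp only [← Finset.sum_add_distrib, ← add_mul, Pi.sup_apply, Pi.inf_apply, max_add_min]
  simp only [Finset.sum_add_distrib] at h1
  unfold lyapunov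
  linarith

end Demand

/-! ### Reduced supply as prohibitive unit prices -/

section Supply

variable {E : Type*} [Fintype E]

/-- The prices of units at which the first `b' e` units of each item `e` cost `p e` each and all
other units cost `M`. -/
def restrictedUnitPrice (b b' : E → ℕ) (p : E → ℝ) (M : ℝ) : (Σ e : E, Fin (b e)) → ℝ :=
  fun u => if u.2.val < b' u.1 then p u.1 else M

theorem utility_unitValuation_eq_of_supply {b b' : E → ℕ} (v : (E → ℕ) → ℕ) {p : E → ℝ}
    {P : (Σ e : E, Fin (b e)) → ℝ} (hP : ∀ u, u.2.val < b' u.1 → P u = p u.1)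
    {S : (Σ e : E, Fin (b e)) → ℕ} (hS : ∀ u, b' u.1 ≤ u.2.val → S u = 0) :
    utility (unitValuation b v) P S = utility v p (countUnits S) := by
  rw [← utility_unitValuation]
  unfold utility
  congr 1
  refine Finset.sum_congr rfl fun u _ => ?_
  rcases lt_or_ge u.2.val (b' u.1) with hu | hu
  · rw [hP u hu]
  · simp [hS u hu]

theorem indirectUtility_le_unitValuation {b b' : E → ℕ} (hb : b' ≤ b) (v : (E → ℕ) → ℕ)
    {p : E → ℝ} {P : (Σ e : E, Fin (b e)) → ℝ} (hP : ∀ u, u.2.val < b' u.1 → P u = p u.1) :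
    indirectUtility b' v p ≤ indirectUtility (fun _ => 1) (unitValuation b v) P := by
  refine indirectUtility_le fun z hz => ?_
  have h1 := utility_le_indirectUtility (v := unitValuation b v) (firstUnits_le b z) P
  rwa [utility_unitValuation_eq_of_supply v hP, countUnits_firstUnits (hz.trans hb)] at h1
  intro u hu
  have := hz u.1
  simp only [firstUnits, ite_eq_right_iff]
  lia

/-- Dropping all units priced at `M` saves at least `M` if there are any, and loses at most `v b`,
by monotonicity and nonnegativity of values. -/
theorem indirectUtility_restrictedUnitPrice_le {b b' : E → ℕ} {v : (E → ℕ) → ℕ}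
    (hv : MonotoneOn v (Set.Iic b)) (p : E → ℝ) {M : ℝ} (hM : v b ≤ M) :
    indirectUtility (fun _ => 1) (unitValuation b v) (restrictedUnitPrice b b' p M) ≤
      indirectUtility b' v p := by
  classical
  refine indirectUtility_le fun S hS => ?_
  have hM0 : 0 ≤ M := (Nat.cast_nonneg _).trans hM
  set T : (Σ e : E, Fin (b e)) → ℕ := fun u => if u.2.val < b' u.1 then S u else 0 with hT
  have hTb : countUnits T ≤ b' := by
    intro e
    have h1 : ∀ k : Fin (b e), T ⟨e, k⟩ ≤ if k.val < b' e then 1 else 0 := by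
      intro k
      simp only [hT]
      split_ifs
      · exact hS _
      · exact le_rfl
    refine (Finset.sum_le_sum fun k _ => h1 k).trans ?_
    rw [Fin.sum_univ_eq_sum_range (fun k => if k < b' e then 1 else 0) (b e), Finset.sum_boole]
    refine (Finset.card_le_card (t := Finset.range (b' e)) fun k hk => ?_).trans (by simp)
    simpa using (Finset.mem_filter.1 hk).2
  refine le_trans ?_ (utility_le_indirectUtility hTb p)
  rw [← utility_unitValuation_eq_of_supply (b' := b') v (P := restrictedUnitPrice b b' p M)
    (fun u hu => by simp [restrictedUnitPrice, hu]) (fun u hu => by simp [hT, hu])]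
  by_cases hST : S = T
  · rw [← hST]
  obtain ⟨x, hx⟩ := Function.ne_iff.1 hST
  have hxb : ¬ x.2.val < b' x.1 := fun h => hx (by simp [hT, h])
  have hx1 : 1 ≤ S x := by
    simp only [hT, if_neg hxb] at hx
    lia
  have hterm : ∀ u, restrictedUnitPrice b b' p M u * (T u : ℝ) +
      (if u = x then M else 0) ≤ restrictedUnitPrice b b' p M u * (S u : ℝ) := by
    intro u
    by_cases hu : u = x
    · subst hu
      have : (1 : ℝ) ≤ S u := by exact_mod_cast hx1
      simp only [hT, if_neg hxb, restrictedUnitPrice, if_true, Nat.cast_zero, mul_zero, zero_add]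
      nlinarith
    · by_cases h : u.2.val < b' u.1
      · simp [hT, h, hu]
      · simp only [hT, if_neg h, restrictedUnitPrice, if_neg hu, Nat.cast_zero, mul_zero,
          add_zero]
        positivity
  have hsum := Finset.sum_le_sum fun u (_ : u ∈ Finset.univ) => hterm u
  rw [Finset.sum_add_distrib, Finset.sum_ite_eq' Finset.univ x] at hsum
  simp only [Finset.mem_univ, if_true] at hsum
  have h1 : (unitValuation b v S : ℝ) ≤ v b := by
    rw [unitValuation_apply]
    exact_mod_cast hv (countUnits_le hS) (Set.mem_Iic.2 le_rfl) (countUnits_le hS)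
  have h2 : (0 : ℝ) ≤ unitValuation b v T := Nat.cast_nonneg _
  unfold utility
  linarith

end Supply

/-! ### Exchange between a market and its restriction to a smaller supply -/

section Supply

variable {E : Type*} [Fintype E]

theorem sum_mul_supply {b b' : E → ℕ} (hb : b' ≤ b) (x : E → ℝ) :
    ∑ e, x e * (b' e : ℝ) =
      ∑ u : Σ e : E, Fin (b e), if u.2.val < b' u.1 then x u.1 else 0 := by
  rw [Fintype.sum_sigma]
  refine Finset.sum_congr rfl fun e _ => ?_
  conv_lhs => rw [← countUnits_firstUnits hb]
  simp only [countUnits, firstUnits, Nat.cast_sum, Nat.cast_ite, Nat.cast_one, Nat.cast_zero,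
    Finset.mul_sum, mul_ite, mul_one, mul_zero]

/-- Submodularity over units is applied to `p` and the restricted prices. The market `b'` sees only
the first `b'` units of each item, which gives the join `p ⊔ p'`. On the other units the meet with
`M` is `p`, so the supply terms balance. -/
theorem isWalrasian_supply_units {N : Type*} [Fintype N] {b b' : E → ℕ} (hb : b' ≤ b)
    {v : N → (E → ℕ) → ℕ} (hv : ∀ i, MonotoneOn (v i) (Set.Iic b))
    (h : ∀ i, IsStrongGrossSubstitutes b (v i)) {p p' : E → ℝ} (hp : IsWalrasian b v p)
    (hp' : IsWalrasian b' v p') {M : ℝ} (hM : ∀ i, (v i b : ℝ) ≤ M) (hM0 : 0 ≤ M)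
    (hpM : ∀ e, p e ≤ M) :
    IsWalrasian (fun _ => 1) (fun i => unitValuation b (v i))
        ((fun u => p u.1) ⊓ restrictedUnitPrice b b' p' M) ∧
      IsWalrasian b' v (p ⊔ p') := by
  refine ((isWalrasian_unitValuation_iff hp.1).2 hp).of_lyapunov_add_le hp'
    (r := (fun u => p u.1) ⊓ restrictedUnitPrice b b' p' M) (r' := p ⊔ p')
    (fun u => le_inf (hp.1 _) ?_) (fun e => le_sup_of_le_left (hp.1 e)) ?_
  · unfold restrictedUnitPrice
    split_ifs
    exacts [hp'.1 _, hM0]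
  have h1 := Finset.sum_le_sum fun i (_ : i ∈ Finset.univ) => (add_le_add_right
    (indirectUtility_le_unitValuation hb (v i) (p := p ⊔ p')
      (P := (fun u => p u.1) ⊔ restrictedUnitPrice b b' p' M)
      (fun u hu => by simp [restrictedUnitPrice, hu])) _).trans
    ((indirectUtility_inf_add_sup_le (h i) (fun u => p u.1) (restrictedUnitPrice b b' p' M)).trans
      (add_le_add_right (indirectUtility_restrictedUnitPrice_le (hv i) p' (hM i)) _))
  have h2 : ∑ u, ((fun u => p u.1) ⊓ restrictedUnitPrice b b' p' M) u * ((1 : ℕ) : ℝ) +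
      ∑ e, (p ⊔ p') e * (b' e : ℝ) =
      ∑ u : Σ e : E, Fin (b e), p u.1 * ((1 : ℕ) : ℝ) + ∑ e, p' e * (b' e : ℝ) := by
    rw [sum_mul_supply hb, sum_mul_supply hb, ← Finset.sum_add_distrib,
      ← Finset.sum_add_distrib]
    refine Finset.sum_congr rfl fun u _ => ?_
    by_cases hu : u.2.val < b' u.1
    · simp [restrictedUnitPrice, hu]
    · simp [restrictedUnitPrice, hu, hpM]
  simp only [Finset.sum_add_distrib] at h1
  unfold lyapunov
  linarith

/-- Walrasian unit prices stay Walrasian if every unit gets the lowest price among the units of its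
item. -/
theorem isWalrasian_of_unitPrice {N : Type*} [Fintype N] [DecidableEq E] {b : E → ℕ}
    {v : N → (E → ℕ) → ℕ} (h : ∀ i, IsStrongGrossSubstitutes b (v i))
    {Q : (Σ e : E, Fin (b e)) → ℝ}
    (hQ : IsWalrasian (fun _ => 1) (fun i => unitValuation b (v i)) Q) {r : E → ℝ}
    (hr : ∀ e, 0 ≤ r e) (hrQ : ∀ u, r u.1 ≤ Q u)
    (hatt : ∀ e, 0 < b e → ∃ k, Q ⟨e, k⟩ = r e) : IsWalrasian b v r := by
  rcases isEmpty_or_nonempty (Σ e : E, Fin (b e)) with hU | ⟨⟨u₀⟩⟩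
  · rw [← isWalrasian_unitValuation_iff hr, Subsingleton.elim (fun u => r u.1) Q]
    exact hQ
  -- The meet over all swaps within an item gives every unit the lowest price of its item, since
  -- some swap brings the cheapest unit into its place.
  set G : Finset ((Σ e : E, Fin (b e)) × (Σ e : E, Fin (b e))) :=
    Finset.univ.filter fun x => x.1.1 = x.2.1 with hG
  have hGne : G.Nonempty := ⟨(u₀, u₀), by simp [hG]⟩
  have hinf : IsWalrasian (fun _ => 1) (fun i => unitValuation b (v i))
      (G.inf' hGne fun x => Q ∘ Equiv.swap x.1 x.2) :=
    Finset.inf'_induction hGne _ (fun _ ha _ hc => ha.inf h hc)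
      fun x hx => hQ.comp_swap (Finset.mem_filter.1 hx).2
  have heq : (G.inf' hGne fun x => Q ∘ Equiv.swap x.1 x.2) = fun u => r u.1 := by
    funext u
    rw [Finset.inf'_apply]
    apply le_antisymm
    · obtain ⟨k, hk⟩ := hatt u.1 (Fin.pos u.2)
      refine (Finset.inf'_le _ (b := (u, ⟨u.1, k⟩)) (by simp [hG])).trans ?_
      simp [hk]
    · refine Finset.le_inf' _ _ fun x hx => ?_
      have hx : x.1.1 = x.2.1 := (Finset.mem_filter.1 hx).2
      have hfst : (Equiv.swap x.1 x.2 u).1 = u.1 := by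
        rw [Equiv.swap_apply_def]
        split_ifs with h1 h2
        · rw [h1, hx]
        · rw [h2, hx]
        · rfl
      rw [← hfst]
      exact hrQ _
  rw [heq] at hinf
  exact (isWalrasian_unitValuation_iff hr).1 hinf

/-- Over units the meet is `p ⊓ p'` on the first `b'` units and `p` on the rest. The lowest price of
an item is therefore `p ⊓ p'` if some supply remains and `p` otherwise, attained at its first unit.
-/
theorem isWalrasian_supply_inf_sup {N : Type*} [Fintype N] [DecidableEq E] {b b' : E → ℕ}
    (hb : b' ≤ b) {v : N → (E → ℕ) → ℕ} (hv : ∀ i, MonotoneOn (v i) (Set.Iic b))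
    (h : ∀ i, IsStrongGrossSubstitutes b (v i)) {p p' : E → ℝ} (hp : IsWalrasian b v p)
    (hp' : IsWalrasian b' v p') :
    IsWalrasian b v (fun e => if 0 < b' e then p e ⊓ p' e else p e) ∧
      IsWalrasian b' v (p ⊔ p') := by
  obtain ⟨M, hM, hM0, hpM⟩ : ∃ M : ℝ, (∀ i, (v i b : ℝ) ≤ M) ∧ 0 ≤ M ∧ ∀ e, p e ≤ M := by
    have h1 : 0 ≤ ∑ i, (v i b : ℝ) := Finset.sum_nonneg fun i _ => Nat.cast_nonneg _
    have h2 : 0 ≤ ∑ e, p e := Finset.sum_nonneg fun e _ => hp.1 e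
    refine ⟨∑ i, (v i b : ℝ) + ∑ e, p e, fun i => ?_, add_nonneg h1 h2, fun e => ?_⟩
    · have := Finset.single_le_sum (f := fun i => (v i b : ℝ))
        (fun i _ => Nat.cast_nonneg _) (Finset.mem_univ i)
      linarith
    · have := Finset.single_le_sum (fun e _ => hp.1 e) (Finset.mem_univ e)
      linarith
  obtain ⟨h1, h2⟩ := isWalrasian_supply_units hb hv h hp hp' hM hM0 hpM
  refine ⟨isWalrasian_of_unitPrice h h1 (fun e => ?_) (fun u => ?_) (fun e he => ?_), h2⟩
  · split_ifs
    exacts [le_inf (hp.1 e) (hp'.1 e), hp.1 e]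
  · by_cases h0 : 0 < b' u.1
    · by_cases hu : u.2.val < b' u.1
      · simp [restrictedUnitPrice, hu, h0]
      · simp [restrictedUnitPrice, hu, h0, hpM]
    · have hu : ¬ u.2.val < b' u.1 := by lia
      simp [restrictedUnitPrice, hu, h0, hpM]
  · refine ⟨⟨0, he⟩, ?_⟩
    by_cases h0 : 0 < b' e
    · simp [restrictedUnitPrice, h0]
    · simp [restrictedUnitPrice, h0, hpM]

end Supply

theorem mainTheorem3 {E N : Type*} [Fintype E] [DecidableEq E] [Fintype N]
    (b : E → ℕ) (v : N → (E → ℕ) → ℕ)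
    (hmono : ∀ i, MonotoneOn (v i) (Set.Iic b))
    (hsgs : ∀ i, IsStrongGrossSubstitutes b (v i)) :
    (∀ b' : E → ℕ, b' ≤ b → ∀ p p' : E → ℝ,
      IsMinWalrasian b v p → IsMinWalrasian b' v p' → ∀ e, 0 < b' e → p e ≤ p' e) ∧
    (∀ b' : E → ℕ, b' ≤ b → ∀ p p' : E → ℝ,
      IsMaxWalrasian b v p → IsMaxWalrasian b' v p' → ∀ e, 0 < b' e → p e ≤ p' e) ∧
    (∀ d d' : N → ℕ, d' ≤ d → ∀ p p' : E → ℝ,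
      IsMinWalrasian b (fun i => truncation (v i) (d i)) p →
      IsMinWalrasian b (fun i => truncation (v i) (d' i)) p' → ∀ e, 0 < b e → p' e ≤ p e) ∧
    (∀ d d' : N → ℕ, d' ≤ d → ∀ p p' : E → ℝ,
      IsMaxWalrasian b (fun i => truncation (v i) (d i)) p →
      IsMaxWalrasian b (fun i => truncation (v i) (d' i)) p' → ∀ e, 0 < b e → p' e ≤ p e) := by
  refine ⟨fun b' hb p p' hp hp' e he => ?_, fun b' hb p p' hp hp' e he => ?_,
    fun d d' hd p p' hp hp' e he => ?_, fun d d' hd p p' hp hp' e he => ?_⟩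
  · have := hp.2 _ (isWalrasian_supply_inf_sup hb hmono hsgs hp.1 hp'.1).1 e
      (he.trans_le (hb e))
    rw [if_pos he] at this
    exact this.trans inf_le_right
  · exact le_sup_left.trans
      (hp'.2 _ (isWalrasian_supply_inf_sup hb hmono hsgs hp.1 hp'.1).2 e he)
  · exact (hp'.2 _ (isWalrasian_truncation_sup_inf hsgs hd hp.1 hp'.1).2 e he).trans inf_le_left
  · exact le_sup_right.trans
      (hp.2 _ (isWalrasian_truncation_sup_inf hsgs hd hp.1 hp'.1).1 e he)
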